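/- **Setting.** A *finite subdivision rule* $R$ of dimension $d$ consists of a finite CW complex $S$ that is the union of its closed $d$-cells (the *tile types*), where the characteristic map of each $d$-cell restricts to a homeomorphism on every open cell of some finite CW structure on the closed $d$-disk whose only $d$-cell is the open disk; a finite subdivision $R(S)$ of $S$, also the union of its closed $d$-cells; and a continuous map $\varphi\colon R(S)\to S$ mapping each open cell homeomorphically onto an open cell of the same dimension. Some tile types are declared *ideal*, in such a way that ideal tiles are subdivided into ideal tiles only. A finite *$R$-complex* is a finite Hausdorff CW complex $X$ that is the union of its closed $d$-cells, with a continuous map $f\colon X\to S$ mapping each open cell homeomorphically onto an open cell of the same dimension. Put $R^0(X)=X$; the cells of $R^{n+1}(X)$ are obtained by pulling the cells of $R(S)$ back to the cells of $R^n(X)$ along $\varphi^n\circ f$. A *tile* of $R^n(X)$ is a closed $d$-cell of $R^n(X)$; it is ideal if the tile type onto which $\varphi^n\circ f$ maps it is ideal. The *dual graph* of $R^n(X)$ has the non-ideal tiles of $R^n(X)$ as vertices, two distinct tiles being adjacent if they share a $(d-1)$-cell. The *history graph* is the disjoint union of the dual graphs of all $R^n(X)$, $n\ge 0$, with an edge from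 each non-ideal tile of $R^n(X)$ to each non-ideal tile of $R^{n+1}(X)$ contained in it, and an origin joined to all non-ideal tiles of $R^0(X)$. **Theorem.** Let $R$ be a finite subdivision rule with ideal tiles and let $X$ be a finite $R$-complex. Suppose that, for every $n$, any two non-ideal tiles of $R^n(X)$ that intersect are joined by a chain of non-ideal tiles of $R^n(X)$ in which consecutive tiles share a $(d-1)$-cell. Let $G$ be a finitely generated group with a Cayley graph (for a finite generating set) quasi-isometric to the history graph. For each $n$ let $R^n_I(X)$ be the ideal region of $R^n(X)$, that is, the interior of the union of the ideal tiles of $R^n(X)$ (equivalently, the complement of the union of the non-ideal tiles). Then the number of ends of $G$ (of this Cayley graph) equals, as a cardinal, the number of connected components of $$X\setminus\bigcup_n R^n_I(X).$$ If moreover every ideal tile of every $R^n(X)$ is contained in $\bigcup_m R^m_I(X)$, the same holds when $R_I^n(X)$ is replaced by the union of the (closed) ideal tiles of $R^n(X)$. -/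

import Mathlib

open Set Topology

universe u v

section CW

variable {Y : Type u} [TopologicalSpace Y] {Z : Type v} [TopologicalSpace Z]

/-- The open cell of index `i` of a CW structure `K` given as an explicit argument. -/
def cwOpenCell {C : Set Y} (K : CWComplex C) (n : ℕ) (i : K.cell n) : Set Y :=
  letI := K
  RelCWComplex.openCell (C := C) n i

/-- The closed cell of index `i` of a CW structure `K` given as an explicit argument. -/
def cwClosedCell {C : Set Y} (K : CWComplex C) (n : ℕ) (i : K.cell n) : Set Y :=
  letI := K
  RelCWComplex.closedCell (C := C) n i

/-- `K` is a finite CW structure of dimension at most `d` on `C`, and `C` is the union of the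
closed `d`-cells (so that `K` is pure of dimension `d`). -/
structure IsFinitePure {C : Set Y} (K : CWComplex C) (d : ℕ) : Prop where
  finite : letI := K; RelCWComplex.Finite C
  isEmpty_of_lt : ∀ n, d < n → IsEmpty (K.cell n)
  iUnion_closedCell : ⋃ i : K.cell d, cwClosedCell K d i = C

/-- `g` restricts to a homeomorphism from each open cell of `K` onto an open cell of `L` of the
same dimension. -/
def IsCellwiseHomeo {C : Set Y} {D : Set Z} (K : CWComplex C) (L : CWComplex D) (g : Y → Z) :
    Prop :=
  ∀ (n : ℕ) (i : K.cell n),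
    IsEmbedding ((cwOpenCell K n i).domRestrict g) ∧
      ∃ j : L.cell n, g '' cwOpenCell K n i = cwOpenCell L n j

/-- `K'` is a subdivision of the CW structure `K` on the same space: every open cell of `K'` lies
in an open cell of `K` (equivalently, every open cell of `K` is a union of open cells of `K'`). -/
def IsCWSubdivision {C : Set Y} (K' K : CWComplex C) : Prop :=
  ∀ (n : ℕ) (c : K'.cell n), ∃ (m : ℕ) (e : K.cell m), cwOpenCell K' n c ⊆ cwOpenCell K m e

end CW

/-- A finite subdivision rule of dimension `d` with subdivision complex `S`, together with a choice
of ideal tile types. The tile types are the `d`-cells of `S`. -/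
structure FiniteSubdivisionRule (d : ℕ) (S : Type u) [TopologicalSpace S] where
  /-- The fixed cell structure of the subdivision complex `S`. -/
  base : CWComplex (univ : Set S)
  base_pure : IsFinitePure base d
  /-- Each characteristic map of a `d`-cell restricts to a homeomorphism on each open cell of some
  finite CW structure on the closed `d`-disk whose only `d`-cell is the interior of the disk, so
  that all its other cells lie in the boundary sphere. -/
  exists_tile : ∀ i : base.cell d, ∃ D : CWComplex (Metric.closedBall (0 : Fin d → ℝ) 1),
    (letI := D; RelCWComplex.Finite (Metric.closedBall (0 : Fin d → ℝ) 1)) ∧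
    (∃ t : D.cell d, cwOpenCell D d t = Metric.ball 0 1) ∧
    IsCellwiseHomeo D base (base.map d i)
  /-- The cell structure of `R(S)`. -/
  subdivided : CWComplex (univ : Set S)
  subdivided_pure : IsFinitePure subdivided d
  isSubdivision : IsCWSubdivision subdivided base
  /-- The subdivision map `φ : R(S) → S`. -/
  φ : S → S
  continuous_φ : Continuous φ
  isCellwiseHomeo_φ : IsCellwiseHomeo subdivided base φ
  /-- The ideal tile types. -/
  ideal : Set (base.cell d)
  /-- Ideal tiles only subdivide into ideal tiles. -/
  ideal_subdivide : ∀ i ∈ ideal, ∀ c : subdivided.cell d,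
    cwOpenCell subdivided d c ⊆ cwOpenCell base d i →
      ∀ j : base.cell d, φ '' cwOpenCell subdivided d c = cwOpenCell base d j → j ∈ ideal

/-- A finite `R`-complex: a finite CW complex `X` which is the union of its closed `d`-cells, with
a continuous cellular map `f : X → S` that restricts to a homeomorphism on each open cell. -/
structure FiniteSubdivisionRule.Complex {d : ℕ} {S : Type u} [TopologicalSpace S]
    (R : FiniteSubdivisionRule d S) (X : Type v) [TopologicalSpace X] where
  cw : CWComplex (univ : Set X)
  cw_pure : IsFinitePure cw d
  f : X → S
  continuous_f : Continuous f
  isCellwiseHomeo_f : IsCellwiseHomeo cw R.base f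

namespace FiniteSubdivisionRule.Complex

variable {d : ℕ} {S : Type u} [TopologicalSpace S] {R : FiniteSubdivisionRule d S}
  {X : Type v} [TopologicalSpace X] (A : R.Complex X)

/-- The structure map `φ^n ∘ f` of the `R`-complex `R^n(X)`. -/
def structureMap (n : ℕ) : X → S := R.φ^[n] ∘ A.f

/-- The open `k`-cells of `R^n(X)`, as subsets of `X`. The cell structure of `R^(n+1)(X)` is
obtained by pulling back, along the structure map of `R^n(X)`, the cells of `R(S)` to each open cell
of `R^n(X)`. -/
def openCells : ℕ → ℕ → Set (Set X)
  | 0, k => {e | ∃ i : A.cw.cell k, e = cwOpenCell A.cw k i}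
  | n + 1, k => {e' | ∃ m, ∃ e ∈ openCells n m, ∃ c : R.subdivided.cell k,
      cwOpenCell R.subdivided k c ⊆ A.structureMap n '' e ∧
      e' = e ∩ A.structureMap n ⁻¹' cwOpenCell R.subdivided k c}

/-- The open `d`-cell `t` of `R^n(X)` has an ideal tile type. -/
def IsIdeal (n : ℕ) (t : Set X) : Prop :=
  ∃ i ∈ R.ideal, A.structureMap n '' t = cwOpenCell R.base d i

/-- The non-ideal tiles of `R^n(X)`. A tile is recorded by its open `d`-cell `t`; the tile itself,
as a subset of `X`, is `closure t`. -/
def NonIdealTile (n : ℕ) : Type v :=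
  {t : Set X // t ∈ A.openCells n d ∧ ¬ A.IsIdeal n t}

/-- The union of the (closed) ideal tiles of `R^n(X)`. -/
def idealUnion (n : ℕ) : Set X :=
  ⋃ t ∈ {t | t ∈ A.openCells n d ∧ A.IsIdeal n t}, closure t

/-- The dual graph of the non-ideal part of `R^n(X)`: two distinct non-ideal tiles are adjacent if
they have a cell of codimension one of `R^n(X)` in common. -/
def dualGraph (n : ℕ) : SimpleGraph (A.NonIdealTile n) :=
  SimpleGraph.fromRel fun t t' =>
    ∃ k, k + 1 = d ∧ ∃ c ∈ A.openCells n k, c ⊆ closure t.1 ∩ closure t'.1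

/-- Vertices of the history graph: the origin, and the non-ideal tiles of all `R^n(X)`. -/
inductive HistoryVertex : Type v
  | origin : HistoryVertex
  | tile (n : ℕ) (t : A.NonIdealTile n) : HistoryVertex

/-- The edges of the history graph, each in one direction. -/
inductive HistoryEdge : A.HistoryVertex → A.HistoryVertex → Prop
  | origin (t : A.NonIdealTile 0) : HistoryEdge .origin (.tile 0 t)
  | dual (n : ℕ) (t t' : A.NonIdealTile n) (h : (A.dualGraph n).Adj t t') :
      HistoryEdge (.tile n t) (.tile n t')
  | subdivision (n : ℕ) (t : A.NonIdealTile n) (t' : A.NonIdealTile (n + 1)) (h : t'.1 ⊆ t.1) :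
      HistoryEdge (.tile n t) (.tile (n + 1) t')

/-- The history graph: the disjoint union of the dual graphs of the `R^n(X)`, with an edge from
each tile of `R^n(X)` to each tile of `R^(n+1)(X)` in its subdivision, and an origin joined to all
tiles of `R^0(X) = X`; ideal tiles are not assigned vertices. -/
def historyGraph : SimpleGraph A.HistoryVertex :=
  SimpleGraph.fromRel A.HistoryEdge

/-- Whenever two non-ideal tiles of some `R^n(X)` intersect, they are joined by a chain of non-ideal
tiles of `R^n(X)` in which consecutive tiles share a cell of codimension one. -/
def NonIdealTilesMeetAlongFacets : Prop :=
  ∀ (n : ℕ) (t t' : A.NonIdealTile n), (closure t.1 ∩ closure t'.1).Nonempty →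
    (A.dualGraph n).Reachable t t'

end FiniteSubdivisionRule.Complex

/-- Quasi-isometry of (connected) graphs, for the graph metrics on the vertices. -/
def SimpleGraph.AreQuasiIsometric {V : Type u} {W : Type v} (Γ : SimpleGraph V)
    (Λ : SimpleGraph W) : Prop :=
  ∃ (q : V → W) (C : ℝ), 0 < C ∧
    (∀ x y : V, (1 / C) * (Λ.dist (q x) (q y) : ℝ) - C ≤ Γ.dist x y ∧
      (Γ.dist x y : ℝ) ≤ C * Λ.dist (q x) (q y) + C) ∧
    ∃ D : ℝ, ∀ w : W, ∃ x : V, (Λ.dist w (q x) : ℝ) ≤ D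

/-! The number of ends is a quasi-isometry invariant of connected locally finite graphs, so the
Cayley graph can be replaced by the history graph (`nonempty_end_equiv_of_areQuasiIsometric`).

Let `Z n` be `nonIdealUnion n`, the union of the closed non-ideal tiles of `R^n(X)`. It is the
complement of the ideal region (`compl_interior_idealUnion`), so the space to be understood is the
intersection of the decreasing compact sets `Z n`. By the facet hypothesis, tiles in different
components of the dual graph are disjoint; the connected components of `Z n` are therefore the
finitely many closed sets `region n c`.

Delete from the history graph the origin and all tiles of `R^k(X)` with `k < n`. Every remaining
tile is still joined to its ancestor in `R^n(X)` (`exists_ancestor`), and adjacent tiles have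
ancestors in one component of the dual graph (`exists_component_of_componentCompl`). The components
left over thus correspond to those of `Z n`, and an end is a compatible sequence of components of
the `Z n`. The intersection along such a sequence is nonempty and connected by compactness
(`iInter_region_nonempty_and_isPreconnected`), and points on different sequences are separated at
some level. Hence sending a point to the end it determines induces a bijection from connected
components to ends (`nonempty_end_historyGraph_equiv`). -/

section CW

/-! ### Topology of finite pure CW complexes. -/

variable {Y : Type u} [TopologicalSpace Y]

theorem cwOpenCell_nonempty {C : Set Y} (K : CWComplex C) (n : ℕ) (i : K.cell n) :
    (cwOpenCell K n i).Nonempty :=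
  let := K
  RelCWComplex.openCell_nonempty (C := C) n i

theorem cwOpenCell_isPreconnected {C : Set Y} (K : CWComplex C) (n : ℕ) (i : K.cell n) :
    IsPreconnected (cwOpenCell K n i) := by
  let := K
  exact (convex_ball (0 : Fin n → ℝ) 1).isPreconnected.image _
    ((RelCWComplex.continuousOn (C := C) n i).mono Metric.ball_subset_closedBall)

theorem sigma_eq_of_mem_cwOpenCell {C : Set Y} (K : CWComplex C) {n m : ℕ} {i : K.cell n}
    {j : K.cell m} {x : Y} (hi : x ∈ cwOpenCell K n i) (hj : x ∈ cwOpenCell K m j) :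
    (⟨n, i⟩ : Σ n, K.cell n) = ⟨m, j⟩ := by
  let := K
  exact RelCWComplex.eq_of_not_disjoint_openCell (C := C) (not_disjoint_iff.2 ⟨x, hi, hj⟩)

theorem eq_of_mem_cwOpenCell {C : Set Y} (K : CWComplex C) {n : ℕ} {i j : K.cell n} {x : Y}
    (hi : x ∈ cwOpenCell K n i) (hj : x ∈ cwOpenCell K n j) : i = j := by
  simpa using sigma_eq_of_mem_cwOpenCell K hi hj

variable {C : Set Y} {K : CWComplex C} {d : ℕ}

theorem IsFinitePure.finite_cells (h : IsFinitePure K d) : Finite (Σ n, K.cell n) := by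
  let := K
  have := h.finite
  exact RelCWComplex.finite_cells_of_finite (C := C)

theorem IsFinitePure.finite_cell (h : IsFinitePure K d) (n : ℕ) : Finite (K.cell n) := by
  have := h.finite_cells
  exact Finite.of_injective (fun i : K.cell n => (⟨n, i⟩ : Σ n, K.cell n)) sigma_mk_injective

theorem cwClosedCell_isCompact (K : CWComplex C) (n : ℕ) (i : K.cell n) :
    IsCompact (cwClosedCell K n i) := by
  let := K
  exact RelCWComplex.isCompact_closedCell (C := C)

theorem IsFinitePure.isCompact (h : IsFinitePure K d) : IsCompact C := by
  have := h.finite_cell d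
  rw [← h.iUnion_closedCell]
  exact isCompact_iUnion fun i => cwClosedCell_isCompact K d i

theorem closure_cwOpenCell [T2Space Y] (K : CWComplex C) (n : ℕ) (i : K.cell n) :
    closure (cwOpenCell K n i) = cwClosedCell K n i := by
  let := K
  exact RelCWComplex.closure_openCell_eq_closedCell (C := C)

theorem IsFinitePure.le (h : IsFinitePure K d) {n : ℕ} (i : K.cell n) : n ≤ d := by
  by_contra hn
  exact (h.isEmpty_of_lt n (not_le.1 hn)).false i

/-- The frontier of an `n`-cell lies in the skeleton of dimension below `n`, which misses all open
cells of dimension at least `n`. -/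
theorem disjoint_cwClosedCell_cwOpenCell [T2Space Y] (K : CWComplex C) {n m : ℕ} (hnm : n ≤ m)
    (j : K.cell n) (i : K.cell m) (hne : (⟨n, j⟩ : Σ n, K.cell n) ≠ ⟨m, i⟩) :
    Disjoint (cwClosedCell K n j) (cwOpenCell K m i) := by
  let := K
  rw [cwClosedCell, ← RelCWComplex.cellFrontier_union_openCell_eq_closedCell]
  refine disjoint_union_left.2 ⟨?_, RelCWComplex.disjoint_openCell_of_ne (C := C) hne⟩
  exact (RelCWComplex.disjoint_skeletonLT_openCell (by exact_mod_cast hnm)).mono_left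
    (RelCWComplex.cellFrontier_subset_skeletonLT (C := C) n j)

/-- All other cells have dimension at most `d`, so their closures miss this open cell; they are
finitely many, and their closures fill its complement. -/
theorem IsFinitePure.isOpen_cwOpenCell [T2Space Y] {K : CWComplex (univ : Set Y)}
    (h : IsFinitePure K d) (i : K.cell d) : IsOpen (cwOpenCell K d i) := by
  have := h.finite_cells
  have key : (cwOpenCell K d i)ᶜ =
      ⋃ σ : {σ : Σ n, K.cell n // σ ≠ ⟨d, i⟩}, cwClosedCell K σ.1.1 σ.1.2 := by
    ext x
    simp only [mem_compl_iff, mem_iUnion]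
    constructor
    · intro hx
      obtain ⟨n, j, hj⟩ : ∃ n, ∃ j : K.cell n, x ∈ cwOpenCell K n j := by
        let := K
        have hx : x ∈ ⋃ n, ⋃ j, RelCWComplex.openCell (C := (univ : Set Y)) n j := by
          rw [CWComplex.iUnion_openCell_eq_complex]
          exact mem_univ x
        obtain ⟨n, hx⟩ := mem_iUnion.1 hx
        obtain ⟨j, hx⟩ := mem_iUnion.1 hx
        exact ⟨n, j, hx⟩
      refine ⟨⟨⟨n, j⟩, ?_⟩, closure_cwOpenCell K n j ▸ subset_closure hj⟩
      intro he
      cases he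
      exact hx hj
    · rintro ⟨⟨⟨n, j⟩, hne⟩, hx⟩ hxi
      exact disjoint_left.1 (disjoint_cwClosedCell_cwOpenCell K (h.le j) j i hne) hx hxi
  rw [← isClosed_compl_iff, key]
  exact isClosed_iUnion_of_finite fun σ => (cwClosedCell_isCompact K _ _).isClosed

theorem IsFinitePure.dense [T2Space Y] {K : CWComplex (univ : Set Y)} (h : IsFinitePure K d) :
    Dense (⋃ i, cwOpenCell K d i) := by
  refine dense_iff_closure_eq.2 (univ_subset_iff.1 (h.iUnion_closedCell.symm.subset.trans ?_))
  refine iUnion_subset fun i => ?_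
  rw [← closure_cwOpenCell]
  exact closure_mono (subset_iUnion _ i)

/-- An open cell containing a nonempty open set is top-dimensional. -/
theorem IsFinitePure.dim_eq_of_isOpen_subset [T2Space Y] {K : CWComplex (univ : Set Y)}
    (h : IsFinitePure K d) {U : Set Y} (hU : IsOpen U) (hne : U.Nonempty) {m : ℕ} {i : K.cell m}
    (hUi : U ⊆ cwOpenCell K m i) : m = d := by
  obtain ⟨x, hx, hxU⟩ := h.dense.inter_open_nonempty U hU hne |>.imp fun x hx => hx.symm
  obtain ⟨j, hj⟩ := mem_iUnion.1 hx
  exact congrArg Sigma.fst (sigma_eq_of_mem_cwOpenCell K (hUi hxU) hj)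

end CW

/-! ### Tiles of the iterated subdivisions. -/

namespace FiniteSubdivisionRule.Complex

variable {d : ℕ} {S : Type u} [TopologicalSpace S] {R : FiniteSubdivisionRule d S}
  {X : Type v} [TopologicalSpace X] (A : R.Complex X)

theorem structureMap_succ (n : ℕ) : A.structureMap (n + 1) = R.φ ∘ A.structureMap n := by
  rw [structureMap, Function.iterate_succ']
  rfl

theorem continuous_structureMap (n : ℕ) : Continuous (A.structureMap n) :=
  (R.continuous_φ.iterate n).comp A.continuous_f

/-- The structure map of `R^n(X)` maps each open cell homeomorphically onto an open cell. -/
theorem structureMap_openCell (n : ℕ) : ∀ k, ∀ e ∈ A.openCells n k,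
    IsEmbedding (e.domRestrict (A.structureMap n)) ∧
      ∃ j, A.structureMap n '' e = cwOpenCell R.base k j := by
  induction n with
  | zero =>
    rintro k e ⟨i, rfl⟩
    exact A.isCellwiseHomeo_f k i
  | succ n ih =>
    rintro k _ ⟨m, e, he, c, hc, rfl⟩
    obtain ⟨hφ, j, hj⟩ := R.isCellwiseHomeo_φ k c
    have hmaps : MapsTo (A.structureMap n) (e ∩ A.structureMap n ⁻¹' cwOpenCell R.subdivided k c)
        (cwOpenCell R.subdivided k c) := fun x hx => hx.2
    rw [structureMap_succ]
    constructor
    · have h1 : IsEmbedding (hmaps.restrict _ _ _) :=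
        (IsEmbedding.subtypeVal.of_comp_iff).1
          ((ih m e he).1.comp (IsEmbedding.inclusion inter_subset_left))
      exact hφ.comp h1
    · refine ⟨j, ?_⟩
      rw [image_comp, image_inter_preimage, inter_eq_right.2 hc, hj]

theorem openCell_nonempty {n k : ℕ} {e : Set X} (he : e ∈ A.openCells n k) : e.Nonempty := by
  obtain ⟨j, hj⟩ := (A.structureMap_openCell n k e he).2
  exact image_nonempty.1 (hj ▸ cwOpenCell_nonempty R.base k j)

theorem openCell_isPreconnected {n k : ℕ} {e : Set X} (he : e ∈ A.openCells n k) :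
    IsPreconnected e := by
  obtain ⟨hemb, j, hj⟩ := A.structureMap_openCell n k e he
  have h : IsPreconnected (e.domRestrict (A.structureMap n) '' univ) := by
    rw [image_univ, range_domRestrict, hj]
    exact cwOpenCell_isPreconnected R.base k j
  have h' := IsInducing.subtypeVal.isPreconnected_image.2 (hemb.isInducing.isPreconnected_image.1 h)
  rwa [image_univ, Subtype.range_coe] at h'

variable [T2Space S]

/-- The open tiles of `R^(n+1)(X)` are cut out of the open tiles of `R^n(X)` by the open tiles of
`R(S)`. -/
theorem exists_of_mem_openCells_succ {n : ℕ} {e' : Set X} (he' : e' ∈ A.openCells (n + 1) d) :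
    ∃ e ∈ A.openCells n d, ∃ c : R.subdivided.cell d,
      cwOpenCell R.subdivided d c ⊆ A.structureMap n '' e ∧
      e' = e ∩ A.structureMap n ⁻¹' cwOpenCell R.subdivided d c := by
  obtain ⟨m, e, he, c, hc, rfl⟩ := he'
  obtain ⟨j, hj⟩ := (A.structureMap_openCell n m e he).2
  -- The open tile `c` of `R(S)` is open in `S` and lies in the open base cell onto which `e` is
  -- mapped, so that cell is top-dimensional.
  obtain rfl : m = d := R.base_pure.dim_eq_of_isOpen_subset
    (R.subdivided_pure.isOpen_cwOpenCell c) (cwOpenCell_nonempty _ _ _) (hj ▸ hc)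
  exact ⟨e, he, c, hc, rfl⟩

theorem finite_openCells (n : ℕ) : (A.openCells n d).Finite := by
  induction n with
  | zero =>
    have := A.cw_pure.finite_cell d
    refine (finite_range fun i => cwOpenCell A.cw d i).subset ?_
    rintro _ ⟨i, rfl⟩
    exact mem_range_self i
  | succ n ih =>
    have := R.subdivided_pure.finite_cell d
    refine (ih.image2 (fun e c => e ∩ A.structureMap n ⁻¹' cwOpenCell R.subdivided d c)
      finite_univ).subset fun e' he' => ?_
    obtain ⟨e, he, c, -, rfl⟩ := A.exists_of_mem_openCells_succ he'
    exact ⟨e, he, c, mem_univ c, rfl⟩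

theorem openCell_eq_of_mem {n : ℕ} {e e' : Set X} (he : e ∈ A.openCells n d)
    (he' : e' ∈ A.openCells n d) {x : X} (hx : x ∈ e) (hx' : x ∈ e') : e = e' := by
  induction n generalizing e e' with
  | zero =>
    obtain ⟨i, rfl⟩ := he
    obtain ⟨i', rfl⟩ := he'
    rw [eq_of_mem_cwOpenCell A.cw hx hx']
  | succ n ih =>
    obtain ⟨e₁, he₁, c, -, rfl⟩ := A.exists_of_mem_openCells_succ he
    obtain ⟨e₂, he₂, c', -, rfl⟩ := A.exists_of_mem_openCells_succ he'
    rw [ih he₁ he₂ hx.1 hx'.1, eq_of_mem_cwOpenCell R.subdivided hx.2 hx'.2]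

theorem exists_openCell_supset {n : ℕ} {e' : Set X} (he' : e' ∈ A.openCells (n + 1) d) :
    ∃ e ∈ A.openCells n d, e' ⊆ e := by
  obtain ⟨e, he, c, -, rfl⟩ := A.exists_of_mem_openCells_succ he'
  exact ⟨e, he, inter_subset_left⟩

/-- A tile contained in an ideal tile of the previous subdivision is ideal. -/
theorem IsIdeal.of_subset {n : ℕ} {e e' : Set X} (he : e ∈ A.openCells n d)
    (he' : e' ∈ A.openCells (n + 1) d) (hee : e' ⊆ e) (hideal : A.IsIdeal n e) :
    A.IsIdeal (n + 1) e' := by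
  obtain ⟨x, hx⟩ := A.openCell_nonempty he'
  obtain ⟨e₁, he₁, c, hc, rfl⟩ := A.exists_of_mem_openCells_succ he'
  obtain rfl := A.openCell_eq_of_mem he he₁ (hee hx) hx.1
  obtain ⟨i, hi, hie⟩ := hideal
  obtain ⟨j, hj⟩ := (R.isCellwiseHomeo_φ d c).2
  refine ⟨j, R.ideal_subdivide i hi c (hie ▸ hc) j hj, ?_⟩
  rw [structureMap_succ, image_comp, image_inter_preimage, inter_eq_right.2 hc, hj]

theorem finite_nonIdealTile (n : ℕ) : Finite (A.NonIdealTile n) :=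
  (A.finite_openCells n).subset fun _ ht => ht.1

variable [T2Space X]

theorem isOpen_openCell {n : ℕ} {e : Set X} (he : e ∈ A.openCells n d) : IsOpen e := by
  induction n generalizing e with
  | zero =>
    obtain ⟨i, rfl⟩ := he
    exact A.cw_pure.isOpen_cwOpenCell i
  | succ n ih =>
    obtain ⟨e₁, he₁, c, -, rfl⟩ := A.exists_of_mem_openCells_succ he
    exact (ih he₁).inter
      ((R.subdivided_pure.isOpen_cwOpenCell c).preimage (A.continuous_structureMap n))

/-- With finiteness, density is what makes the closed tiles cover `X`. In the inductive step a small
open set inside a tile is transported to `S`, where the tiles of `R(S)` are dense. -/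
theorem dense_sUnion_openCells (n : ℕ) : Dense (⋃₀ A.openCells n d) := by
  induction n with
  | zero =>
    refine A.cw_pure.dense.mono (iUnion_subset fun i => ?_)
    exact subset_sUnion_of_mem (show cwOpenCell A.cw d i ∈ A.openCells 0 d from ⟨i, rfl⟩)
  | succ n ih =>
    rw [dense_iff_inter_open]
    intro U hU hUne
    obtain ⟨x, hxU, e, he, hxe⟩ := ih.inter_open_nonempty U hU hUne
    obtain ⟨hemb, j, hj⟩ := A.structureMap_openCell n d e he
    obtain ⟨O, hO, hOU⟩ := hemb.isInducing.isOpen_iff.1 (hU.preimage continuous_subtype_val)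
    have hxO : A.structureMap n x ∈ O := by
      have : (⟨x, hxe⟩ : e) ∈ e.domRestrict (A.structureMap n) ⁻¹' O := hOU ▸ hxU
      exact this
    have hxj : A.structureMap n x ∈ cwOpenCell R.base d j := hj ▸ mem_image_of_mem _ hxe
    obtain ⟨s, ⟨hsO, hsj⟩, hs⟩ := R.subdivided_pure.dense.inter_open_nonempty _
      (hO.inter (R.base_pure.isOpen_cwOpenCell j)) ⟨_, hxO, hxj⟩
    obtain ⟨c, hc⟩ := mem_iUnion.1 hs
    -- The base cell containing `c` shares the point `s` with the image of `e`, hence is that image.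
    obtain ⟨m, i, hmi⟩ := R.isSubdivision d c
    have hci : cwOpenCell R.subdivided d c ⊆ A.structureMap n '' e := by
      have := sigma_eq_of_mem_cwOpenCell R.base (hmi hc) hsj
      cases this
      rwa [hj]
    obtain ⟨y, hye, rfl⟩ := hci hc
    have hyU : (⟨y, hye⟩ : e) ∈ (Subtype.val ⁻¹' U : Set e) := hOU ▸ hsO
    exact ⟨y, hyU, _, ⟨d, e, he, c, hci, rfl⟩, hye, hc⟩

theorem exists_mem_closure_openCell (n : ℕ) (x : X) :
    ∃ e ∈ A.openCells n d, x ∈ closure e := by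
  have h : x ∈ closure (⋃₀ A.openCells n d) := A.dense_sUnion_openCells n x
  rw [(A.finite_openCells n).closure_sUnion] at h
  simpa using h

/-- The union of the closed non-ideal tiles of `R^n(X)`. -/
def nonIdealUnion (n : ℕ) : Set X := ⋃ t : A.NonIdealTile n, closure t.1

/-- Open tiles are open and pairwise disjoint, so an open non-ideal tile misses every closed ideal
tile. Conversely, closed tiles cover `X`, so a point in no ideal tile lies in a non-ideal one. -/
theorem compl_interior_idealUnion (n : ℕ) : (interior (A.idealUnion n))ᶜ = A.nonIdealUnion n := by
  have := A.finite_nonIdealTile n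
  rw [← closure_compl]
  apply Subset.antisymm
  · refine closure_minimal (fun x hx => ?_) (isClosed_iUnion_of_finite fun _ => isClosed_closure)
    obtain ⟨e, he, hxe⟩ := A.exists_mem_closure_openCell n x
    by_cases hi : A.IsIdeal n e
    · exact (hx (mem_biUnion (show e ∈ {t | t ∈ A.openCells n d ∧ A.IsIdeal n t} from ⟨he, hi⟩)
        hxe)).elim
    · exact mem_iUnion.2 ⟨⟨e, he, hi⟩, hxe⟩
  · refine iUnion_subset fun t => closure_mono fun x hx hxI => ?_
    obtain ⟨e, ⟨he, hei⟩, hxe⟩ := mem_iUnion₂.1 hxI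
    obtain ⟨y, hyt, hye⟩ := mem_closure_iff.1 hxe t.1 (A.isOpen_openCell t.2.1) hx
    exact t.2.2 (A.openCell_eq_of_mem t.2.1 he hyt hye ▸ hei)

end FiniteSubdivisionRule.Complex

/-! ### Ends of graphs and their quasi-isometry invariance. -/

namespace SimpleGraph

variable {V : Type u} {W : Type v} {G : SimpleGraph V} {H : SimpleGraph W}

/-- In a connected graph with finite neighborhoods, bounded neighborhoods of finite sets are
finite. -/
theorem finite_setOf_exists_dist_le (hG : G.Connected) (hfin : ∀ x, (G.neighborSet x).Finite)
    (r : ℕ) : ∀ {K : Set V}, K.Finite → {x | ∃ k ∈ K, G.dist k x ≤ r}.Finite := by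
  induction r with
  | zero =>
    intro K hK
    refine hK.subset ?_
    rintro x ⟨k, hk, h⟩
    rwa [← (hG.dist_eq_zero_iff).1 (Nat.le_zero.1 h)]
  | succ r ih =>
    intro K hK
    have hK' : (K ∪ ⋃ k ∈ K, G.neighborSet k).Finite :=
      hK.union (hK.biUnion fun k _ => hfin k)
    refine (ih hK').subset ?_
    rintro x ⟨k, hk, h⟩
    obtain ⟨p, hp⟩ := (hG.preconnected k x).exists_walk_length_eq_dist
    cases p with
    | nil => exact ⟨x, Or.inl hk, by simp⟩
    | cons a q =>
      -- The first step of a geodesic lands in the enlarged set and leaves a distance of at most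
      -- `r`.
      refine ⟨_, Or.inr (mem_biUnion hk a), ?_⟩
      rw [Walk.length_cons] at hp
      have := dist_le q
      omega

theorem exists_componentComplMk_eq_of_walk {K : Set V} {x y : V} (p : G.Walk x y)
    (hp : ∀ z ∈ p.support, z ∉ K) :
    ∃ (hx : x ∉ K) (hy : y ∉ K), G.componentComplMk hx = G.componentComplMk hy := by
  induction p with
  | nil => exact ⟨hp _ (by simp), hp _ (by simp), rfl⟩
  | cons a q ih =>
    obtain ⟨hx, hy, h⟩ := ih fun z hz => hp z (by simp [hz])
    have hu := hp _ (Walk.start_mem_support _)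
    exact ⟨hu, hy, (G.componentComplMk_eq_of_adj hu hx a).trans h⟩

/-- Two vertices closer to each other than the first one is to `K` lie in the same component of the
complement of `K`. -/
theorem exists_componentComplMk_eq_of_dist_le (hG : G.Connected) {K : Set V} {x y : V} {r : ℕ}
    (hxy : G.dist x y ≤ r) (hx : ¬ ∃ k ∈ K, G.dist k x ≤ r) :
    ∃ (hx : x ∉ K) (hy : y ∉ K), G.componentComplMk hx = G.componentComplMk hy := by
  obtain ⟨p, hp⟩ := (hG.preconnected x y).exists_walk_length_eq_dist
  -- A vertex of `K` on the geodesic would be within `r` of `x`.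
  refine exists_componentComplMk_eq_of_walk p fun z hz hzK => hx ⟨z, hzK, ?_⟩
  classical
  have h1 := dist_le (p.takeUntil z hz)
  have h2 := p.length_takeUntil_le_length hz
  rw [dist_comm]
  omega

/-- The component of the complement of the finite set `K` selected by an end. -/
def endComp (e : G.end) (K : Finset V) : G.ComponentCompl (K : Set V) := e.1 (Opposite.op K)

theorem hom_endComp (e : G.end) {K L : Finset V} (h : K ⊆ L) :
    (endComp e L).hom (Finset.coe_subset.2 h) = endComp e K :=
  e.2 (CategoryTheory.opHomOfLE h)

theorem mem_endComp_mono (e : G.end) {K L : Finset V} (h : K ⊆ L) {x : V}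
    (hx : x ∈ endComp e L) : x ∈ endComp e K := by
  rw [← hom_endComp e h]
  exact ComponentCompl.subset_hom _ _ hx

theorem ComponentCompl.eq_of_mem {K : Set V} {C D : G.ComponentCompl K} {x : V} (hC : x ∈ C)
    (hD : x ∈ D) : C = D := by
  obtain ⟨h, rfl⟩ := hC
  obtain ⟨_, rfl⟩ := hD
  rfl

theorem end_ext {e e' : G.end} (h : ∀ K, ∃ x, x ∈ endComp e K ∧ x ∈ endComp e' K) : e = e' := by
  refine Subtype.ext (funext fun K => ?_)
  obtain ⟨x, hx, hx'⟩ := h K.unop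
  exact ComponentCompl.eq_of_mem hx hx'

/-- An end constructed from components of the complements of finite sets. -/
def endMk (c : ∀ K : Finset V, G.ComponentCompl (K : Set V))
    (hc : ∀ K L : Finset V, K ⊆ L → ∃ x, x ∈ c L ∧ x ∈ c K) : G.end :=
  ⟨fun K => c K.unop, fun {L K} f => by
    obtain ⟨x, hL, hK⟩ := hc K.unop L.unop (CategoryTheory.le_of_op_hom f)
    exact ComponentCompl.eq_of_mem
      (ComponentCompl.subset_hom _ (CategoryTheory.le_of_op_hom f) hL) hK⟩

/-- A proper coarse map between graphs induces a map on ends. -/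
theorem exists_end_of_coarse (hH : H.Connected) (hfin : ∀ x, (H.neighborSet x).Finite)
    {h : V → W} {r : ℕ} (hr : ∀ x y, G.Adj x y → H.dist (h x) (h y) ≤ r)
    (hprop : ∀ F : Set W, F.Finite → (h ⁻¹' F).Finite) (e : G.end) :
    ∃ e' : H.end, ∀ L : Finset W, ∃ K : Finset V, ∀ x ∈ endComp e K, h x ∈ endComp e' L := by
  -- Outside the preimage of the `r`-neighborhood of `L`, adjacent vertices have images joined by a
  -- geodesic avoiding `L`; components therefore map to components.
  let N (L : Finset W) : Set W := {w | ∃ k ∈ (L : Set W), H.dist k w ≤ r}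
  have hN (L) : (N L).Finite := finite_setOf_exists_dist_le hH hfin r L.finite_toSet
  let K (L : Finset W) : Finset V := (hprop _ (hN L)).toFinset
  have hK {L : Finset W} {x : V} (hx : x ∉ (K L : Set V)) :
      ¬ ∃ k ∈ (L : Set W), H.dist k (h x) ≤ r := by simpa [K, N] using hx
  have hKmono {L L' : Finset W} (hL : L ⊆ L') : K L ⊆ K L' := by
    intro x hx
    simp only [K, N, Finite.mem_toFinset, mem_preimage, mem_ofPred_eq] at hx ⊢
    obtain ⟨k, hk, h⟩ := hx
    exact ⟨k, hL hk, h⟩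
  have hL {L : Finset W} {x : V} (hx : x ∉ (K L : Set V)) : h x ∉ (L : Set W) := fun hxL =>
    hK hx ⟨_, hxL, by simp⟩
  let Φ (L : Finset W) : G.ComponentCompl (K L : Set V) → H.ComponentCompl (L : Set W) :=
    ComponentCompl.lift (fun x hx => H.componentComplMk (hL hx)) fun x y hx hy hxy => by
      obtain ⟨_, _, h⟩ := exists_componentComplMk_eq_of_dist_le hH (hr x y hxy) (hK hx)
      exact h
  have hΦ {L : Finset W} {C} {x : V} (hx : x ∈ C) : h x ∈ Φ L C := by
    obtain ⟨hx, rfl⟩ := hx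
    exact ⟨hL hx, rfl⟩
  refine ⟨endMk (fun L => Φ L (endComp e (K L))) fun L L' hLL => ?_,
    fun L => ⟨K L, fun x hx => hΦ hx⟩⟩
  obtain ⟨x, hx⟩ := (endComp e (K L')).nonempty
  exact ⟨h x, hΦ hx, hΦ (mem_endComp_mono e (hKmono hLL) hx)⟩

/-- A vertex far out along `e` and farther than `D` from `K` is not separated by `K` from its image
under `h' ∘ h`, and that image lies in the component chosen by `e''`. -/
theorem end_eq_of_coarse_inverse (hG : G.Connected) (hfin : ∀ x, (G.neighborSet x).Finite)
    {h : V → W} {h' : W → V} {D : ℕ} (hD : ∀ x, G.dist x (h' (h x)) ≤ D)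
    {e e'' : G.end} {e' : H.end}
    (he' : ∀ L : Finset W, ∃ K : Finset V, ∀ x ∈ endComp e K, h x ∈ endComp e' L)
    (he'' : ∀ K : Finset V, ∃ L : Finset W, ∀ x ∈ endComp e' L, h' x ∈ endComp e'' K) :
    e'' = e := by
  classical
  refine end_ext fun K => ?_
  obtain ⟨L, hL⟩ := he'' K
  obtain ⟨K₁, hK₁⟩ := he' L
  let K₂ : Finset V := (finite_setOf_exists_dist_le hG hfin D K.finite_toSet).toFinset
  obtain ⟨x, hx⟩ := (endComp e (K₁ ∪ K ∪ K₂)).nonempty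
  have hx₂ : x ∉ (K₂ : Set V) := fun hx' =>
    ComponentCompl.notMem_of_mem hx (by simp at hx' ⊢; tauto)
  have hxK : x ∈ endComp e K := mem_endComp_mono e (fun _ _ => by simp_all) hx
  refine ⟨h' (h x), hL _ (hK₁ _ (mem_endComp_mono e (fun _ _ => by simp_all) hx)), ?_⟩
  obtain ⟨h1, h2, h3⟩ := exists_componentComplMk_eq_of_dist_le hG (hD x)
    (K := (K : Set V)) (by simpa [K₂] using hx₂)
  obtain ⟨_, h4⟩ := hxK
  exact ⟨h2, h3.symm.trans h4⟩

/-- The ends of a connected graph with finite neighborhoods are a quasi-isometry invariant. -/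
theorem nonempty_end_equiv_of_areQuasiIsometric (hG : G.Connected)
    (hGfin : ∀ x, (G.neighborSet x).Finite) (hH : H.Connected)
    (hHfin : ∀ x, (H.neighborSet x).Finite) (hGH : G.AreQuasiIsometric H) :
    Nonempty (G.end ≃ H.end) := by
  obtain ⟨q, C, hC, hq, D, hD⟩ := hGH
  choose q' hq' using hD
  have upper (x y : V) : (H.dist (q x) (q y) : ℝ) ≤ C * (G.dist x y + C) := by
    have := (hq x y).1
    rw [one_div, sub_le_iff_le_add, inv_mul_le_iff₀ hC] at this
    exact this
  have lower (x y : V) := (hq x y).2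
  have hGball (x : V) (r : ℝ) : {y | (G.dist x y : ℝ) ≤ r}.Finite := by
    refine (finite_setOf_exists_dist_le hG hGfin ⌈r⌉₊ (finite_singleton x)).subset ?_
    intro y hy
    exact ⟨x, rfl, by exact_mod_cast hy.trans (Nat.le_ceil r)⟩
  have hHball (x : W) (r : ℝ) : {y | (H.dist x y : ℝ) ≤ r}.Finite := by
    refine (finite_setOf_exists_dist_le hH hHfin ⌈r⌉₊ (finite_singleton x)).subset ?_
    intro y hy
    exact ⟨x, rfl, by exact_mod_cast hy.trans (Nat.le_ceil r)⟩
  have hqprop (F : Set W) (hF : F.Finite) : (q ⁻¹' F).Finite := by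
    refine hF.preimage' fun w _ => ?_
    rcases (q ⁻¹' {w}).eq_empty_or_nonempty with h | ⟨x, hx⟩
    · simp [h]
    -- Two points of one fiber of `q` are at distance at most `C`, by the additive constant alone.
    · refine (hGball x C).subset fun y hy => ?_
      have := lower x y
      rw [hx, hy] at this
      simpa using this
  have hq'prop (F : Set V) (hF : F.Finite) : (q' ⁻¹' F).Finite := by
    refine hF.preimage' fun x _ => (hHball (q x) D).subset ?_
    rintro w rfl
    have := hq' w
    rwa [dist_comm] at this
  have triangle (w w' : W) : (H.dist (q (q' w)) (q (q' w')) : ℝ) ≤ 2 * D + H.dist w w' := by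
    have h1 : H.dist (q (q' w)) (q (q' w')) ≤
        H.dist (q (q' w)) w + (H.dist w w' + H.dist w' (q (q' w'))) :=
      hH.dist_triangle.trans (Nat.add_le_add_left hH.dist_triangle _)
    have h2 := hq' w
    rw [dist_comm] at h2
    have h3 := hq' w'
    have h4 : (H.dist (q (q' w)) (q (q' w')) : ℝ) ≤
        H.dist (q (q' w)) w + (H.dist w w' + H.dist w' (q (q' w'))) := by exact_mod_cast h1
    linarith
  have hqadj (x y : V) (hxy : G.Adj x y) : H.dist (q x) (q y) ≤ ⌈C * (1 + C)⌉₊ := by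
    have h := upper x y
    rw [dist_eq_one_iff_adj.2 hxy, Nat.cast_one] at h
    exact_mod_cast h.trans (Nat.le_ceil _)
  have hq'adj (w w' : W) (hw : H.Adj w w') :
      G.dist (q' w) (q' w') ≤ ⌈C * (2 * D + 1) + C⌉₊ := by
    have h := triangle w w'
    rw [dist_eq_one_iff_adj.2 hw, Nat.cast_one] at h
    have h' : (G.dist (q' w) (q' w') : ℝ) ≤ C * (2 * D + 1) + C :=
      (lower _ _).trans (by gcongr)
    exact_mod_cast h'.trans (Nat.le_ceil _)
  have hid (w : W) : H.dist w (q (q' w)) ≤ ⌈D⌉₊ := by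
    exact_mod_cast (hq' w).trans (Nat.le_ceil _)
  have hid' (x : V) : G.dist x (q' (q x)) ≤ ⌈C * D + C⌉₊ := by
    have h : (G.dist x (q' (q x)) : ℝ) ≤ C * D + C :=
      (lower _ _).trans (by gcongr; exact hq' (q x))
    exact_mod_cast h.trans (Nat.le_ceil _)
  choose Φ hΦ using exists_end_of_coarse hH hHfin hqadj hqprop
  choose Ψ hΨ using exists_end_of_coarse hG hGfin hq'adj hq'prop
  exact ⟨⟨Φ, Ψ, fun e => end_eq_of_coarse_inverse hG hGfin hid' (hΦ e) (hΨ _),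
    fun e => end_eq_of_coarse_inverse hH hHfin hid (hΨ e) (hΦ _)⟩⟩

theorem mulCayley_connected {Γ : Type u} [Group Γ] {T : Set Γ} (hT : Subgroup.closure T = ⊤) :
    (mulCayley T).Connected := by
  have key (x g : Γ) : (mulCayley T).Reachable x (x * g) := by
    have hg : g ∈ Subgroup.closure T := hT ▸ Subgroup.mem_top g
    induction hg using Subgroup.closure_induction generalizing x with
    | mem t ht =>
      -- The identity may be a generator, and then contributes no edge.
      by_cases h : x = x * t
      · rw [← h]
      · exact Adj.reachable ((mulCayley_adj T _ _).2 ⟨h, Or.inl (by simpa using ht)⟩)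
    | one => simp
    | mul g g' _ _ ih ih' => exact (ih x).trans (by simpa [mul_assoc] using ih' (x * g))
    | inv g _ ih => simpa using (ih (x * g⁻¹)).symm
  exact (connected_iff _).2 ⟨fun x y => by simpa using key x (x⁻¹ * y), ⟨1⟩⟩

theorem finite_neighborSet_mulCayley {Γ : Type u} [Group Γ] {T : Set Γ} (hT : T.Finite) (x : Γ) :
    ((mulCayley T).neighborSet x).Finite := by
  refine ((hT.image (x * ·)).union (hT.image fun t => x * t⁻¹)).subset fun y hy => ?_
  obtain ⟨-, h | h⟩ := (mulCayley_adj T x y).1 hy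
  · exact Or.inl ⟨_, h, by simp⟩
  · exact Or.inr ⟨_, h, by simp⟩

end SimpleGraph

/-- A decreasing intersection of connected closed subsets of a compact Hausdorff space is
connected. -/
theorem isPreconnected_iInter_of_antitone {X : Type u} [TopologicalSpace X] [T2Space X]
    [CompactSpace X] {Z : ℕ → Set X} (hanti : Antitone Z) (hclosed : ∀ n, IsClosed (Z n))
    (hconn : ∀ n, IsPreconnected (Z n)) : IsPreconnected (⋂ n, Z n) := by
  rw [isPreconnected_iff_subset_of_fully_disjoint_closed (isClosed_iInter hclosed)]
  intro u v hu hv huv hdisj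
  obtain ⟨U, V, hU, hV, huU, hvV, hUV⟩ := normal_separation hu hv hdisj
  -- By compactness some `Z n` already lies in `U ∪ V`; being connected, it lies in one of the two.
  obtain ⟨n, hn⟩ := exists_subset_nhds_of_isCompact (directed_of_isDirected_le hanti)
    (fun n => (hclosed n).isCompact) (U := U ∪ V) fun x hx =>
      (hU.union hV).mem_nhds ((huv hx).imp (@huU x) (@hvV x))
  have hsub : ⋂ n, Z n ⊆ Z n := iInter_subset Z n
  rcases (hconn n).subset_or_subset hU hV hUV hn with h | h
  · exact Or.inl fun x hx => (huv hx).resolve_right fun hxv =>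
      disjoint_left.1 hUV (h (hsub hx)) (hvV hxv)
  · exact Or.inr fun x hx => (huv hx).resolve_left fun hxu =>
      disjoint_left.1 hUV (huU hxu) (h (hsub hx))

theorem SimpleGraph.ComponentCompl.mem_iff_of_adj {V : Type u} {G : SimpleGraph V} {K : Set V}
    (C : G.ComponentCompl K) {x y : V} (hx : x ∉ K) (hy : y ∉ K) (h : G.Adj x y) :
    x ∈ C ↔ y ∈ C :=
  ⟨fun hC => mem_of_adj x y hC hy h, fun hC => mem_of_adj y x hC hx h.symm⟩

/-! ### The history graph, its ends, and the components of the limit set. -/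

namespace FiniteSubdivisionRule.Complex

variable {d : ℕ} {S : Type u} [TopologicalSpace S] {R : FiniteSubdivisionRule d S}
  {X : Type v} [TopologicalSpace X] (A : R.Complex X)

variable {A}

/-- The distance of a vertex of the history graph from the origin. -/
def HistoryVertex.level : A.HistoryVertex → ℕ
  | .origin => 0
  | .tile n _ => n + 1

theorem HistoryEdge.level_le {v w : A.HistoryVertex} (h : A.HistoryEdge v w) :
    v.level ≤ w.level ∧ w.level ≤ v.level + 1 := by
  cases h <;> simp [HistoryVertex.level]

theorem level_le_of_adj {v w : A.HistoryVertex} (h : A.historyGraph.Adj v w) :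
    w.level ≤ v.level + 1 := by
  rcases ((SimpleGraph.fromRel_adj _ _ _).1 h).2 with h | h
  · exact h.level_le.2
  · exact h.level_le.1.trans (Nat.le_succ _)

theorem adj_of_historyEdge {v w : A.HistoryVertex} (hne : v ≠ w) (h : A.HistoryEdge v w) :
    A.historyGraph.Adj v w :=
  (SimpleGraph.fromRel_adj _ _ _).2 ⟨hne, Or.inl h⟩

theorem adj_tile_of_subset {n : ℕ} {t : A.NonIdealTile n} {t' : A.NonIdealTile (n + 1)}
    (h : t'.1 ⊆ t.1) : A.historyGraph.Adj (.tile n t) (.tile (n + 1) t') :=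
  adj_of_historyEdge (by simp) (.subdivision n t t' h)

theorem adj_tile_of_adj {n : ℕ} {t t' : A.NonIdealTile n} (h : (A.dualGraph n).Adj t t') :
    A.historyGraph.Adj (.tile n t) (.tile n t') :=
  adj_of_historyEdge (by simpa using h.ne) (.dual n t t' h)

theorem closure_inter_nonempty_of_dualGraph_adj {n : ℕ} {t t' : A.NonIdealTile n}
    (h : (A.dualGraph n).Adj t t') : (closure t.1 ∩ closure t'.1).Nonempty := by
  rcases ((SimpleGraph.fromRel_adj _ _ _).1 h).2 with h | h
  · obtain ⟨k, -, c, hc, hcc⟩ := h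
    exact (A.openCell_nonempty hc).mono hcc
  · obtain ⟨k, -, c, hc, hcc⟩ := h
    exact (A.openCell_nonempty hc).mono (hcc.trans (inter_comm _ _).subset)

theorem HistoryEdge.closure_inter_nonempty {n m : ℕ} {t : A.NonIdealTile n} {t' : A.NonIdealTile m}
    (h : A.HistoryEdge (.tile n t) (.tile m t')) : (closure t.1 ∩ closure t'.1).Nonempty := by
  cases h with
  | dual _ _ _ h => exact closure_inter_nonempty_of_dualGraph_adj h
  | subdivision _ _ t' h =>
    exact (A.openCell_nonempty t'.2.1).mono
      (subset_inter (h.trans subset_closure) subset_closure)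

theorem closure_inter_nonempty_of_adj {n m : ℕ} {t : A.NonIdealTile n} {t' : A.NonIdealTile m}
    (h : A.historyGraph.Adj (.tile n t) (.tile m t')) :
    (closure t.1 ∩ closure t'.1).Nonempty := by
  rcases ((SimpleGraph.fromRel_adj _ _ _).1 h).2 with h | h
  · exact h.closure_inter_nonempty
  · exact inter_comm (closure t.1) _ ▸ h.closure_inter_nonempty

/-- A component of the dual graph at level `n` is not separated by removing vertices of level at
most `n` from the history graph. -/
theorem tile_mem_iff_of_reachable {n : ℕ} {a b : A.NonIdealTile n}
    (h : (A.dualGraph n).Reachable a b) {L : Set A.HistoryVertex} (hL : ∀ v ∈ L, v.level ≤ n)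
    (C : A.historyGraph.ComponentCompl L) :
    HistoryVertex.tile n a ∈ C ↔ HistoryVertex.tile n b ∈ C := by
  -- Tiles of `R^n(X)` have level `n + 1`, just beyond the deleted levels.
  have hnot (t : A.NonIdealTile n) : HistoryVertex.tile n t ∉ L := fun ht => by
    simpa [HistoryVertex.level] using hL _ ht
  obtain ⟨p⟩ := h
  induction p with
  | nil => rfl
  | cons h q ih => exact (C.mem_iff_of_adj (hnot _) (hnot _) (adj_tile_of_adj h)).trans ih

variable (A) in
/-- The union of the closed tiles in a component of the dual graph. -/
def region (n : ℕ) (c : (A.dualGraph n).ConnectedComponent) : Set X :=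
  ⋃ t ∈ {t | (A.dualGraph n).connectedComponentMk t = c}, closure t.1

theorem mem_region {n : ℕ} {c : (A.dualGraph n).ConnectedComponent} {x : X} :
    x ∈ A.region n c ↔
      ∃ t, (A.dualGraph n).connectedComponentMk t = c ∧ x ∈ closure t.1 := by
  simp [region]

theorem region_subset {n : ℕ} {c : (A.dualGraph n).ConnectedComponent} :
    A.region n c ⊆ A.nonIdealUnion n := fun _ hx =>
  let ⟨t, _, ht⟩ := mem_region.1 hx
  mem_iUnion.2 ⟨t, ht⟩

theorem region_nonempty (n : ℕ) (c : (A.dualGraph n).ConnectedComponent) :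
    (A.region n c).Nonempty := by
  induction c using SimpleGraph.ConnectedComponent.ind with | _ t =>
  obtain ⟨x, hx⟩ := A.openCell_nonempty t.2.1
  exact ⟨x, mem_region.2 ⟨t, rfl, subset_closure hx⟩⟩

theorem isPreconnected_region (n : ℕ) (c : (A.dualGraph n).ConnectedComponent) :
    IsPreconnected (A.region n c) := by
  refine IsPreconnected.biUnion_of_reflTransGen
    (fun t _ => (A.openCell_isPreconnected t.2.1).closure) ?_
  rintro s hs t ht
  have h := (SimpleGraph.reachable_iff_reflTransGen s t).1
    (SimpleGraph.ConnectedComponent.exact (hs.trans ht.symm))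
  clear ht
  induction h with
  | refl => exact .refl
  | tail hsb hbc ih =>
    refine ih.tail ⟨closure_inter_nonempty_of_dualGraph_adj hbc, ?_⟩
    exact (SimpleGraph.ConnectedComponent.sound
      ((SimpleGraph.reachable_iff_reflTransGen _ _).2 hsb)).symm.trans hs

variable [T2Space S]

theorem exists_parent {n : ℕ} (t : A.NonIdealTile (n + 1)) :
    ∃ a : A.NonIdealTile n, t.1 ⊆ a.1 := by
  obtain ⟨e, he, hte⟩ := A.exists_openCell_supset t.2.1
  exact ⟨⟨e, he, fun h => t.2.2 (h.of_subset A he t.2.1 hte)⟩, hte⟩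

/-- Every non-ideal tile lies in a non-ideal tile of each earlier level, and is not separated from
it by removing earlier levels of the history graph. -/
theorem exists_ancestor {n m : ℕ} (hnm : n ≤ m) (t : A.NonIdealTile m) :
    ∃ a : A.NonIdealTile n, t.1 ⊆ a.1 ∧
      ∀ L : Set A.HistoryVertex, (∀ v ∈ L, v.level ≤ n) →
        ∀ C : A.historyGraph.ComponentCompl L,
          HistoryVertex.tile m t ∈ C ↔ HistoryVertex.tile n a ∈ C := by
  induction m, hnm using Nat.le_induction with
  | base => exact ⟨t, Subset.rfl, fun _ _ _ => Iff.rfl⟩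
  | succ m hnm ih =>
    obtain ⟨b, hb⟩ := exists_parent t
    obtain ⟨a, ha, h⟩ := ih b
    refine ⟨a, hb.trans ha, fun L hL C => (C.mem_iff_of_adj ?_ ?_ (adj_tile_of_subset hb).symm).trans
      (h L hL C)⟩ <;>
    · intro hmem
      have := hL _ hmem
      simp only [HistoryVertex.level] at this
      omega

variable (A)

theorem historyGraph_connected : A.historyGraph.Connected := by
  have key (v : A.HistoryVertex) : A.historyGraph.Reachable .origin v := by
    cases v with
    | origin => rfl
    | tile n t =>
      induction n with
      | zero => exact (adj_of_historyEdge (by simp) (.origin t)).reachable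
      | succ n ih =>
        obtain ⟨a, ha⟩ := exists_parent t
        exact (ih a).trans (adj_tile_of_subset ha).reachable
  exact (SimpleGraph.connected_iff _).2 ⟨fun v w => (key v).symm.trans (key w), ⟨.origin⟩⟩

theorem finite_setOf_level_le (n : ℕ) : {v : A.HistoryVertex | v.level ≤ n}.Finite := by
  refine ((finite_singleton HistoryVertex.origin).union ((finite_lt_nat n).biUnion fun m _ =>
    have := A.finite_nonIdealTile m
    finite_range (HistoryVertex.tile m))).subset fun v hv => ?_
  cases v with
  | origin => exact Or.inl rfl
  | tile m t => exact Or.inr (mem_biUnion (show m < n from hv) (mem_range_self t))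

theorem finite_neighborSet_historyGraph (v : A.HistoryVertex) :
    (A.historyGraph.neighborSet v).Finite :=
  (A.finite_setOf_level_le (v.level + 1)).subset fun _ hw => level_le_of_adj hw

/-- The vertices of level at most `n` of the history graph. -/
noncomputable def levelFinset (n : ℕ) : Finset A.HistoryVertex :=
  (A.finite_setOf_level_le n).toFinset

variable {A}

@[simp]
theorem mem_levelFinset {n : ℕ} {v : A.HistoryVertex} : v ∈ A.levelFinset n ↔ v.level ≤ n := by
  simp [levelFinset]

theorem tile_eq_of_subset {n m : ℕ} {t : A.NonIdealTile m} {a b : A.NonIdealTile n}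
    (ha : t.1 ⊆ a.1) (hb : t.1 ⊆ b.1) : a = b := by
  obtain ⟨x, hx⟩ := A.openCell_nonempty t.2.1
  exact Subtype.ext (A.openCell_eq_of_mem a.2.1 b.2.1 (ha hx) (hb hx))

/-- The component of the dual graph at level `n` below a component of the levels from `n` on of the
history graph. -/
theorem exists_component_of_componentCompl (hA : A.NonIdealTilesMeetAlongFacets) {n : ℕ}
    (C : A.historyGraph.ComponentCompl (A.levelFinset n : Set A.HistoryVertex)) :
    ∃ c : (A.dualGraph n).ConnectedComponent, ∀ (m : ℕ) (t : A.NonIdealTile m)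
      (a : A.NonIdealTile n), HistoryVertex.tile m t ∈ C → t.1 ⊆ a.1 →
        (A.dualGraph n).connectedComponentMk a = c := by
  have hanc (v : A.HistoryVertex) (hv : v ∉ (A.levelFinset n : Set A.HistoryVertex)) :
      ∃ (m : ℕ) (t : A.NonIdealTile m) (a : A.NonIdealTile n), v = .tile m t ∧ t.1 ⊆ a.1 := by
    cases v with
    | origin => simp [HistoryVertex.level] at hv
    | tile m t =>
      obtain ⟨a, ha, -⟩ := exists_ancestor (n := n) (m := m)
        (by simpa [HistoryVertex.level, Nat.lt_succ_iff] using hv) t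
      exact ⟨m, t, a, rfl, ha⟩
  choose m t a hvt hta using hanc
  let f : A.historyGraph.ComponentCompl (A.levelFinset n : Set A.HistoryVertex) →
      (A.dualGraph n).ConnectedComponent :=
    SimpleGraph.ComponentCompl.lift (fun v hv => (A.dualGraph n).connectedComponentMk (a v hv))
      fun v w hv hw hvw => by
        -- Adjacent tiles have intersecting closures, hence so do their ancestors, and the facet
        -- hypothesis applies at level `n`.
        rw [hvt v hv, hvt w hw] at hvw
        exact SimpleGraph.ConnectedComponent.sound (hA n _ _
          ((closure_inter_nonempty_of_adj hvw).mono
            (inter_subset_inter (closure_mono (hta v hv)) (closure_mono (hta w hw)))))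
  refine ⟨f C, fun m' t' a' htC hta' => ?_⟩
  obtain ⟨hv, rfl⟩ := htC
  obtain ⟨h1, h2⟩ := HistoryVertex.tile.inj (hvt _ hv)
  have h3 : t'.1 = (t _ hv).1 := by
    clear_value f
    generalize t _ hv = s at *
    generalize m _ hv = k at *
    subst h1
    rw [eq_of_heq h2]
  exact congrArg _ (tile_eq_of_subset hta' (h3.subset.trans (hta _ hv)))

/-- Consecutive tiles of a chain meet, so their ancestors meet, and the facet hypothesis joins these
at the coarser level. -/
theorem reachable_of_subset (hA : A.NonIdealTilesMeetAlongFacets) {n m : ℕ}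
    {s s' : A.NonIdealTile m} (h : (A.dualGraph m).Reachable s s') (hnm : n ≤ m)
    {a a' : A.NonIdealTile n} (ha : s.1 ⊆ a.1) (ha' : s'.1 ⊆ a'.1) :
    (A.dualGraph n).Reachable a a' := by
  obtain ⟨p⟩ := h
  induction p generalizing a with
  | nil => rw [tile_eq_of_subset ha ha']
  | @cons _ w _ h q ih =>
    obtain ⟨b, hb, -⟩ := exists_ancestor hnm w
    exact (hA n a b ((closure_inter_nonempty_of_dualGraph_adj h).mono
      (inter_subset_inter (closure_mono ha) (closure_mono hb)))).trans (ih hb ha')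

theorem isClosed_region (n : ℕ) (c : (A.dualGraph n).ConnectedComponent) :
    IsClosed (A.region n c) := by
  have := A.finite_nonIdealTile n
  exact (toFinite _).isClosed_biUnion fun _ _ => isClosed_closure

/-- Within a connected subset of the non-ideal tiles, all tiles belong to one component of the dual
graph. -/
theorem reachable_of_isPreconnected (hA : A.NonIdealTilesMeetAlongFacets) {n : ℕ} {P : Set X}
    (hP : IsPreconnected P) (hPn : P ⊆ A.nonIdealUnion n) {x y : X} (hx : x ∈ P) (hy : y ∈ P)
    {t t' : A.NonIdealTile n} (hxt : x ∈ closure t.1) (hyt : y ∈ closure t'.1) :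
    (A.dualGraph n).Reachable t t' := by
  have := A.finite_nonIdealTile n
  by_contra hne
  let c := (A.dualGraph n).connectedComponentMk t
  have hcl : IsClosed (⋃ s ∈ {s | (A.dualGraph n).connectedComponentMk s ≠ c}, closure s.1) :=
    (toFinite _).isClosed_biUnion fun _ _ => isClosed_closure
  -- If `t` and `t'` were in different components, the region of `t` and the union of all other
  -- closed tiles would be two closed sets covering `P`; they would meet in `P`, against the facet
  -- hypothesis.
  obtain ⟨z, -, hz, hz'⟩ := isPreconnected_closed_iff.1 hP _ _ (isClosed_region n c) hcl
    (fun z hz => by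
      obtain ⟨s, hs⟩ := mem_iUnion.1 (hPn hz)
      by_cases h : (A.dualGraph n).connectedComponentMk s = c
      · exact Or.inl (mem_biUnion h hs)
      · exact Or.inr (mem_biUnion h hs))
    ⟨x, hx, mem_region.2 ⟨t, rfl, hxt⟩⟩
    ⟨y, hy, mem_biUnion (fun h => hne (SimpleGraph.ConnectedComponent.exact h).symm) hyt⟩
  obtain ⟨s, hs, hzs⟩ := mem_region.1 hz
  obtain ⟨s', hs', hzs'⟩ := mem_iUnion₂.1 hz'
  exact hs' ((SimpleGraph.ConnectedComponent.sound (hA n s s' ⟨z, hzs, hzs'⟩)).symm.trans hs)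

/-- A point in no ideal region determines an end of the history graph. -/
theorem exists_end_of_mem (hA : A.NonIdealTilesMeetAlongFacets) {x : X}
    (hx : ∀ n, x ∈ A.nonIdealUnion n) :
    ∃ e : A.historyGraph.end, ∀ (L : Finset A.HistoryVertex) (n : ℕ), (∀ v ∈ L, v.level ≤ n) →
      ∀ t : A.NonIdealTile n, x ∈ closure t.1 →
        HistoryVertex.tile n t ∈ SimpleGraph.endComp e L := by
  choose t ht using fun n => mem_iUnion.1 (hx n)
  -- From index `N L` on, all tiles lie outside `L`; those containing `x` select a single component
  -- there.
  let N (L : Finset A.HistoryVertex) : ℕ := L.sup HistoryVertex.level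
  have hN {L : Finset A.HistoryVertex} {v : A.HistoryVertex} (hv : v ∈ L) : v.level ≤ N L :=
    Finset.le_sup hv
  have hnot (L : Finset A.HistoryVertex) :
      HistoryVertex.tile (N L) (t (N L)) ∉ (L : Set A.HistoryVertex) := fun h => by
    simpa [HistoryVertex.level] using hN h
  let c (L : Finset A.HistoryVertex) : A.historyGraph.ComponentCompl (L : Set A.HistoryVertex) :=
    A.historyGraph.componentComplMk (hnot L)
  have hc {L : Finset A.HistoryVertex} {n : ℕ} (hn : N L ≤ n) {s : A.NonIdealTile n}
      (hs : x ∈ closure s.1) : HistoryVertex.tile n s ∈ c L := by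
    obtain ⟨a, ha, h⟩ := exists_ancestor hn s
    rw [h _ (fun v hv => hN hv), tile_mem_iff_of_reachable
      (hA _ a (t (N L)) ⟨x, closure_mono ha hs, ht _⟩) (fun v hv => hN hv)]
    exact A.historyGraph.componentComplMk_mem _
  refine ⟨SimpleGraph.endMk c fun K L hKL => ⟨_, hc le_rfl (ht (N L)), ?_⟩,
    fun L n hn s hs => hc (Finset.sup_le hn) hs⟩
  exact hc (Finset.sup_mono hKL) (ht (N L))

variable [T2Space X]

/-- A compatible sequence of components of the dual graphs determines a connected set. -/
theorem iInter_region_nonempty_and_isPreconnected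
    (c : ∀ n, (A.dualGraph n).ConnectedComponent)
    (hc : ∀ n (s : A.NonIdealTile (n + 1)) (a : A.NonIdealTile n),
      (A.dualGraph (n + 1)).connectedComponentMk s = c (n + 1) → s.1 ⊆ a.1 →
        (A.dualGraph n).connectedComponentMk a = c n) :
    (⋂ n, A.region n (c n)).Nonempty ∧ IsPreconnected (⋂ n, A.region n (c n)) := by
  have : CompactSpace X := ⟨A.cw_pure.isCompact⟩
  have hanti : Antitone fun n => A.region n (c n) := antitone_nat_of_succ_le fun n x hx => by
    obtain ⟨s, hs, hxs⟩ := mem_region.1 hx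
    obtain ⟨a, ha⟩ := exists_parent s
    exact mem_region.2 ⟨a, hc n s a hs ha, closure_mono ha hxs⟩
  exact ⟨IsCompact.nonempty_iInter_of_directed_nonempty_isCompact_isClosed _
    (directed_of_isDirected_le hanti) (fun n => region_nonempty n _)
    (fun n => (isClosed_region n _).isCompact) fun n => isClosed_region n _,
    isPreconnected_iInter_of_antitone hanti (fun n => isClosed_region n _)
      fun n => isPreconnected_region n _⟩

/-- The ends of the history graph are in bijection with the components of the set of points that
lie in no ideal region. -/
theorem nonempty_end_historyGraph_equiv (hA : A.NonIdealTilesMeetAlongFacets) :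
    Nonempty (A.historyGraph.end ≃ ConnectedComponents ↥(⋂ n, A.nonIdealUnion n)) := by
  choose F hF using fun x : ↥(⋂ n, A.nonIdealUnion n) => exists_end_of_mem hA (mem_iInter.1 x.2)
  have htile (x : ↥(⋂ n, A.nonIdealUnion n)) (n : ℕ) :
      ∃ t : A.NonIdealTile n, (x : X) ∈ closure t.1 := mem_iUnion.1 (mem_iInter.1 x.2 n)
  choose τ hτ using htile
  -- An end selects a component of each dual graph; these are compatible, and any point in the
  -- intersection of their regions is sent to the given end.
  have hsurj : Function.Surjective F := fun e => by
    choose c hc using fun n =>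
      exists_component_of_componentCompl hA (SimpleGraph.endComp e (A.levelFinset n))
    have hex (n : ℕ) : ∃ (m : ℕ) (t : A.NonIdealTile m) (a : A.NonIdealTile n),
        HistoryVertex.tile m t ∈ SimpleGraph.endComp e (A.levelFinset n) ∧ t.1 ⊆ a.1 ∧
        HistoryVertex.tile n a ∈ SimpleGraph.endComp e (A.levelFinset n) := by
      obtain ⟨v, hv⟩ := (SimpleGraph.endComp e (A.levelFinset n)).nonempty
      have hv' := SimpleGraph.ComponentCompl.notMem_of_mem hv
      cases v with
      | origin => simp [HistoryVertex.level] at hv'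
      | tile m t =>
        obtain ⟨a, ha, h⟩ := exists_ancestor (n := n) (m := m)
          (by simpa [HistoryVertex.level, Nat.lt_succ_iff] using hv') t
        exact ⟨m, t, a, hv, ha, (h _ (fun v hv => by simpa using hv) _).1 hv⟩
    obtain ⟨⟨x, hx⟩, -⟩ := iInter_region_nonempty_and_isPreconnected c fun n s a hs hsa => by
      obtain ⟨m, t, b, ht, htb, -⟩ := hex (n + 1)
      obtain ⟨b', hb'⟩ := exists_parent b
      have h1 := hc (n + 1) m t b ht htb
      -- The same tile `t` serves at both levels, since the component of an end beyond level `n + 1`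
      -- is contained in the one beyond level `n`.
      have h2 := hc n m t b' (SimpleGraph.mem_endComp_mono e
        (fun v hv => by simp at hv ⊢; omega) ht) (htb.trans hb')
      rw [← h2]
      exact SimpleGraph.ConnectedComponent.sound (reachable_of_subset hA
        (SimpleGraph.ConnectedComponent.exact (hs.trans h1.symm)) (Nat.le_succ n) hsa hb')
    refine ⟨⟨x, mem_iInter.2 fun n => region_subset (mem_iInter.1 hx n)⟩,
      SimpleGraph.end_ext fun L => ?_⟩
    let n := L.sup HistoryVertex.level
    have hL : ∀ v ∈ L, v.level ≤ n := fun v hv => Finset.le_sup hv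
    obtain ⟨s, hs, hxs⟩ := mem_region.1 (mem_iInter.1 hx n)
    refine ⟨.tile n s, hF _ L n hL s hxs, ?_⟩
    obtain ⟨m, t, a, ht, hta, ha⟩ := hex n
    refine SimpleGraph.mem_endComp_mono e (L := A.levelFinset n)
      (fun v hv => by simpa using hL v hv) ?_
    rw [tile_mem_iff_of_reachable (SimpleGraph.ConnectedComponent.exact
      (hs.trans (hc n m t a ht hta).symm)) (fun v hv => by simpa using hv)]
    exact ha
  have hiff (x y : ↥(⋂ n, A.nonIdealUnion n)) :
      F x = F y ↔ (x : ConnectedComponents ↥(⋂ n, A.nonIdealUnion n)) = y := by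
    rw [ConnectedComponents.coe_eq_coe]
    constructor
    · intro hxy
      -- Equal ends put `x` and `y` in the same region at every level; the intersection of these
      -- regions is a connected set containing both.
      let c (n : ℕ) := (A.dualGraph n).connectedComponentMk (τ x n)
      have hcy (n : ℕ) : (A.dualGraph n).connectedComponentMk (τ y n) = c n := by
        have hlevel : ∀ v ∈ A.levelFinset n, v.level ≤ n := fun v hv => by simpa using hv
        have h1 := hF x (A.levelFinset n) n hlevel (τ x n) (hτ x n)
        have h2 := hF y (A.levelFinset n) n hlevel (τ y n) (hτ y n)
        rw [← hxy] at h2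
        obtain ⟨k, hk⟩ := exists_component_of_componentCompl hA
          (SimpleGraph.endComp (F x) (A.levelFinset n))
        exact (hk n _ _ h2 Subset.rfl).trans (hk n _ _ h1 Subset.rfl).symm
      obtain ⟨-, hconn⟩ := iInter_region_nonempty_and_isPreconnected c fun n s a hs hsa => by
        obtain ⟨b, hb⟩ := exists_parent (τ x (n + 1))
        exact SimpleGraph.ConnectedComponent.sound ((reachable_of_subset hA
          (SimpleGraph.ConnectedComponent.exact hs) (Nat.le_succ n) hsa hb).trans
            (hA n _ _ ⟨x, closure_mono hb (hτ x _), hτ x n⟩))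
      have hsub : ⋂ n, A.region n (c n) ⊆ ⋂ n, A.nonIdealUnion n :=
        iInter_mono fun n => region_subset
      have hconn' : IsPreconnected
          (Subtype.val ⁻¹' (⋂ n, A.region n (c n)) : Set ↥(⋂ n, A.nonIdealUnion n)) := by
        rw [← IsInducing.subtypeVal.isPreconnected_image, Subtype.image_preimage_coe,
          inter_eq_right.2 hsub]
        exact hconn
      refine connectedComponent_eq (hconn'.subset_connectedComponent
        (mem_iInter.2 fun n => mem_region.2 ⟨τ x n, rfl, hτ x n⟩)
        (mem_iInter.2 fun n => mem_region.2 ⟨τ y n, hcy n, hτ y n⟩))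
    · intro hxy
      refine SimpleGraph.end_ext fun L => ?_
      let n := L.sup HistoryVertex.level
      have hL : ∀ v ∈ L, v.level ≤ n := fun v hv => Finset.le_sup hv
      refine ⟨_, hF x L n hL _ (hτ x n), ?_⟩
      -- Conversely, a connected set within every `Z n` cannot leave one component of the dual
      -- graph.
      have hP : IsPreconnected (Subtype.val '' connectedComponent x) :=
        isPreconnected_connectedComponent.image _ continuous_subtype_val.continuousOn
      rw [tile_mem_iff_of_reachable (reachable_of_isPreconnected hA (n := n) hP ?_
        (mem_image_of_mem _ mem_connectedComponent)
        (mem_image_of_mem _ (hxy ▸ mem_connectedComponent : y ∈ connectedComponent x))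
        (hτ x n) (hτ y n)) hL]
      · exact hF y L n hL _ (hτ y n)
      · rintro _ ⟨z, -, rfl⟩
        exact mem_iInter.1 z.2 n
  let s := Function.surjInv
    (ConnectedComponents.surjective_coe (α := ↥(⋂ n, A.nonIdealUnion n)))
  have hs : ∀ k, (s k : ConnectedComponents ↥(⋂ n, A.nonIdealUnion n)) = k :=
    Function.surjInv_eq _
  refine ⟨(Equiv.ofBijective (fun k => F (s k)) ⟨fun k k' h => ?_, fun e => ?_⟩).symm⟩
  · rw [← hs k, ← hs k']
    exact (hiff _ _).1 h
  · obtain ⟨x, rfl⟩ := hsurj e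
    exact ⟨x, (hiff _ _).2 (hs _)⟩

end FiniteSubdivisionRule.Complex

/-- Let `G` be a finitely generated group and `A` a finite `R`-complex structure on `X` whose
history graph is quasi-isometric to a Cayley graph of `G`. The ends of `G` are in bijection with the
connected components of what is left of `X` when the ideal regions of all `R^n(X)` are removed. -/
theorem mainTheorem6 {d : ℕ} {S : Type*} [TopologicalSpace S] [T2Space S]
    (R : FiniteSubdivisionRule d S) {X : Type*} [TopologicalSpace X] [T2Space X]
    (A : R.Complex X) (hA : A.NonIdealTilesMeetAlongFacets)
    {G : Type*} [Group G] (T : Set G) (hTfin : T.Finite) (hTgen : Subgroup.closure T = ⊤)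
    (hG : A.historyGraph.AreQuasiIsometric (SimpleGraph.mulCayley T)) :
    Nonempty ((SimpleGraph.mulCayley T).end ≃
      ConnectedComponents ↥((⋃ n, interior (A.idealUnion n))ᶜ)) ∧
    ((∀ n, A.idealUnion n ⊆ ⋃ m, interior (A.idealUnion m)) →
      Nonempty ((SimpleGraph.mulCayley T).end ≃
        ConnectedComponents ↥((⋃ n, A.idealUnion n)ᶜ))) := by
  have main : Nonempty ((SimpleGraph.mulCayley T).end ≃
      ConnectedComponents ↥((⋃ n, interior (A.idealUnion n))ᶜ)) := by
    obtain ⟨f⟩ := SimpleGraph.nonempty_end_equiv_of_areQuasiIsometric A.historyGraph_connected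
      A.finite_neighborSet_historyGraph (SimpleGraph.mulCayley_connected hTgen)
      (SimpleGraph.finite_neighborSet_mulCayley hTfin) hG
    obtain ⟨g⟩ := FiniteSubdivisionRule.Complex.nonempty_end_historyGraph_equiv hA
    have heq : (⋃ n, interior (A.idealUnion n))ᶜ = ⋂ n, A.nonIdealUnion n := by
      simp_rw [compl_iUnion, A.compl_interior_idealUnion]
    rw [heq]
    exact ⟨f.symm.trans g⟩
  refine ⟨main, fun h => ?_⟩
  -- Under the extra hypothesis, both versions remove the same set.
  have heq : ⋃ n, A.idealUnion n = ⋃ n, interior (A.idealUnion n) :=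
    (iUnion_subset h).antisymm (iUnion_mono fun n => interior_subset)
  rwa [heq]
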